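/- Let $n,m\ge 1$. For $d\ge 1$ let $\sigma_{\mathbb R^d}$ be the set of lean dyadic boxes of dimension $d$: the cubes $\prod_{i=1}^{d}\left[\frac{k_i}{2^{s}},\frac{k_i+2}{2^{s}}\right]$ with $s\in\mathbb N$ and $k_1,\dots,k_d\in\mathbb Z$, together with a maximal dot standing for the whole space $\mathbb R^d$. Write $a\preceq b$ (refinement) if the box $a$ is contained in the box $b$, write $a\prec b$ if moreover $a\neq b$, and write $a\,\#\,b$ (apartness) if $a$ and $b$ are disjoint. A point of $\sigma_{\mathbb R^d}$ is a sequence $p=p_0,p_1,\dots$ of boxes such that $p_{k+1}\preceq p_k$ for all $k$, for every $k$ there is $l$ with $p_l\prec p_k$, and whenever $a\,\#\,b$ there is $l$ with $p_l\,\#\,a$ or $p_l\,\#\,b$. Points $p,q$ are apart, $p\,\#\,q$, if $p_k\,\#\,q_k$ for some $k$, and equivalent, $p\equiv q$, otherwise. With these data $\sigma_{\mathbb R^d}$ is a spraid (a natural space in which every box has finitely many predecessors, all immediate-successor trails from the maximal dot to a given box have the same length, and every infinite $\prec$-decreasing sequence is a point). The boxes of a point $p$ have exactly one common element $\operatorname{val}(p)\in\mathbb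 R^d$; every element of $\mathbb R^d$ is of this form, and $\operatorname{val}(p)=\operatorname{val}(q)$ if and only if $p\equiv q$. A refinement morphism from $\sigma_{\mathbb R^n}$ to $\sigma_{\mathbb R^m}$ is a map $g$ from boxes to boxes such that (i) $g(p)=g(p_0),g(p_1),\dots$ is a point for every point $p$; (ii) $g(p)\,\#\,g(q)$ implies $p\,\#\,q$ for all points $p,q$; (iii) $a\preceq b$ implies $g(a)\preceq g(b)$ for all boxes $a,b$. Let $f:\mathbb R^n\to\mathbb R^m$ be Bishop-continuous, that is, uniformly continuous on every compact subset of $\mathbb R^n$. Then there is a refinement morphism $g$ from $\sigma_{\mathbb R^n}$ to $\sigma_{\mathbb R^m}$ such that $\operatorname{val}(g(p))=f(\operatorname{val}(p))$ for every point $p$ of $\sigma_{\mathbb R^n}$. -/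

import Mathlib

namespace NaturalTopology

/-- A pre-natural space: a countable set of basic dots with a decidable pre-apartness and a
decidable refinement relation. -/
structure PreNaturalSpace where
  /-- The basic dots. -/
  Dot : Type
  countable : Nonempty (ℕ ≃ Dot)
  /-- `Apart a b`: the dots `a` and `b` lie apart. -/
  Apart : Dot → Dot → Prop
  /-- `Refines a b`: the dot `a` is a refinement of the dot `b`. -/
  Refines : Dot → Dot → Prop
  decApart : DecidableRel Apart
  decRefines : DecidableRel Refines
  apart_comm : ∀ a b, Apart a b ↔ Apart b a
  apart_irrefl : ∀ a, ¬ Apart a a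
  apart_mono : ∀ a b c, Refines a b → Apart c b → Apart c a
  refines_refl : ∀ a, Refines a a
  refines_trans : ∀ a b c, Refines a b → Refines b c → Refines a c
  refines_antisymm : ∀ a b, Refines a b → Refines b a → a = b

namespace PreNaturalSpace

variable (V : PreNaturalSpace)

/-- Strict refinement. -/
def StrictRefines (a b : V.Dot) : Prop := V.Refines a b ∧ a ≠ b

/-- A sequence of dots is a point when it is shrinking, infinitely often strictly, and chooses
between any two dots that lie apart. -/
def IsPoint (p : ℕ → V.Dot) : Prop :=
  (∀ n, V.Refines (p (n + 1)) (p n) ∧ ∃ m, V.StrictRefines (p m) (p n)) ∧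
  ∀ a b, V.Apart a b → ∃ m, V.Apart (p m) a ∨ V.Apart (p m) b

/-- The set of points of a pre-natural space. -/
def Point : Type := {p : ℕ → V.Dot // V.IsPoint p}

/-- Apartness of points. -/
def PointApart (p q : V.Point) : Prop := ∃ n, V.Apart (p.1 n) (q.1 n)

/-- Equivalence of points: not being apart. -/
def PointEquiv (p q : V.Point) : Prop := ¬ V.PointApart p q

/-- The point `p` belongs to the dot `a`. -/
def BelongsTo (p : V.Point) (a : V.Dot) : Prop := ∃ m, V.StrictRefines (p.1 m) a

/-- `a` is a successor (an immediate strict refinement) of `c`. -/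
def Succ (a c : V.Dot) : Prop :=
  V.StrictRefines a c ∧ ∀ b, V.StrictRefines a b → V.Refines b c → b = c

/-- There is a trail of `n` successor steps `b 0, …, b n` leading from `c` to `a`. -/
def HasSuccTrail (n : ℕ) (c a : V.Dot) : Prop :=
  ∃ b : ℕ → V.Dot, b 0 = c ∧ b n = a ∧ ∀ i < n, V.Succ (b (i + 1)) (b i)

end PreNaturalSpace

/-- A natural space: a pre-natural space with a maximal dot, in which every dot contains a
point. -/
structure NaturalSpace extends PreNaturalSpace where
  maxDot : Dot
  refines_maxDot : ∀ a, Refines a maxDot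
  exists_point : ∀ a, ∃ p : toPreNaturalSpace.Point, toPreNaturalSpace.BelongsTo p a

/-- The dots form a trea: every dot has finitely many predecessors, and all successor trails from
the maximal dot to a given dot have the same length. -/
def NaturalSpace.IsTrea (V : NaturalSpace) : Prop :=
  (∀ a : V.Dot, {b : V.Dot | V.Refines a b}.Finite) ∧
  ∃ grd : V.Dot → ℕ, ∀ (a : V.Dot) (n : ℕ), V.HasSuccTrail n V.maxDot a → n = grd a

/-- A spraid: a natural space whose dots form a trea and in which every infinite strictly shrinking
sequence of dots is a point. -/
structure Spraid extends NaturalSpace where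
  isTrea : toNaturalSpace.IsTrea
  isPoint_of_strict : ∀ p : ℕ → Dot,
    (∀ n, toPreNaturalSpace.StrictRefines (p (n + 1)) (p n)) → toPreNaturalSpace.IsPoint p

/-- A refinement morphism between natural spaces: a map on dots that sends points to points,
reflects apartness of points, and respects refinement. -/
structure RefinementMorphism (V W : NaturalSpace) where
  toFun : V.Dot → W.Dot
  isPoint_map : ∀ p : V.Point, W.IsPoint (fun k => toFun (p.1 k))
  apart_of_map : ∀ p q : V.Point,
    W.PointApart ⟨fun k => toFun (p.1 k), isPoint_map p⟩ ⟨fun k => toFun (q.1 k), isPoint_map q⟩ →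
      V.PointApart p q
  refines_map : ∀ a b : V.Dot, V.Refines a b → W.Refines (toFun a) (toFun b)

/-- The function on points induced by a refinement morphism. -/
def RefinementMorphism.map {V W : NaturalSpace} (g : RefinementMorphism V W) (p : V.Point) :
    W.Point :=
  ⟨fun k => g.toFun (p.1 k), g.isPoint_map p⟩

/-- The lean dyadic boxes of dimension `n`: the maximal dot `whole`, standing for the whole space,
and the cubes `∏ i, [k i / 2 ^ s, (k i + 2) / 2 ^ s]`. -/
inductive LeanBox (n : ℕ) : Type
  | whole : LeanBox n
  | cube (s : ℕ) (k : Fin n → ℤ) : LeanBox n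

namespace LeanBox

variable {n : ℕ}

/-- Left end point of `[j / 2 ^ s, (j + 2) / 2 ^ s]`. -/
def lo (s : ℕ) (j : ℤ) : ℚ := (j : ℚ) / 2 ^ s

/-- Right end point of `[j / 2 ^ s, (j + 2) / 2 ^ s]`. -/
def hi (s : ℕ) (j : ℤ) : ℚ := ((j : ℚ) + 2) / 2 ^ s

/-- Two boxes lie apart when their projections to some coordinate are disjoint intervals. -/
def Apart : LeanBox n → LeanBox n → Prop
  | cube s k, cube t l => ∃ i, hi s (k i) < lo t (l i) ∨ hi t (l i) < lo s (k i)
  | _, _ => False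

/-- Refinement is inclusion of boxes, expressed through the end points. -/
def Refines : LeanBox n → LeanBox n → Prop
  | _, whole => True
  | whole, cube _ _ => False
  | cube s k, cube t l => ∀ i, lo t (l i) ≤ lo s (k i) ∧ hi s (k i) ≤ hi t (l i)

/-- The subset of `ℝⁿ` that a box stands for. -/
def toSet : LeanBox n → Set (EuclideanSpace ℝ (Fin n))
  | whole => Set.univ
  | cube s k => {x | ∀ i, ((lo s (k i) : ℚ) : ℝ) ≤ x i ∧ x i ≤ ((hi s (k i) : ℚ) : ℝ)}

instance decApart : DecidableRel (Apart (n := n))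
  | whole, whole => isFalse id
  | whole, cube _ _ => isFalse id
  | cube _ _, whole => isFalse id
  | cube s k, cube t l =>
    inferInstanceAs (Decidable (∃ i, hi s (k i) < lo t (l i) ∨ hi t (l i) < lo s (k i)))

instance decRefines : DecidableRel (Refines (n := n))
  | whole, whole => isTrue trivial
  | cube _ _, whole => isTrue trivial
  | whole, cube _ _ => isFalse id
  | cube s k, cube t l =>
    inferInstanceAs (Decidable (∀ i, lo t (l i) ≤ lo s (k i) ∧ hi s (k i) ≤ hi t (l i)))

theorem nonempty_equiv : Nonempty (ℕ ≃ LeanBox n) := by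
  have hc : Countable (LeanBox n) := by
    let e : LeanBox n → Option (ℕ × (Fin n → ℤ)) := fun a =>
      match a with
      | whole => none
      | cube s k => some (s, k)
    refine Function.Injective.countable (f := e) ?_
    rintro (_ | ⟨s, k⟩) (_ | ⟨t, l⟩) h <;> simp [e] at h <;> simp [h]
  have hi : Infinite (LeanBox n) :=
    Infinite.of_injective (fun s : ℕ => cube s (0 : Fin n → ℤ)) (fun s t h => by
      simpa using h)
  obtain ⟨d⟩ := nonempty_denumerable (LeanBox n)
  exact ⟨(Denumerable.eqv (LeanBox n)).symm⟩

theorem lo_lt_hi (s : ℕ) (j : ℤ) : lo s j < hi s j := by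
  unfold lo hi
  gcongr
  linarith

theorem hi_eq (s : ℕ) (j : ℤ) : hi s j = lo s j + 2 / 2 ^ s := by
  unfold lo hi
  ring

theorem apart_comm (a b : LeanBox n) : Apart a b ↔ Apart b a := by
  rcases a with _ | ⟨s, k⟩ <;> rcases b with _ | ⟨t, l⟩ <;> simp only [Apart]
  exact exists_congr fun i => or_comm

theorem apart_irrefl (a : LeanBox n) : ¬ Apart a a := by
  rcases a with _ | ⟨s, k⟩ <;> simp only [Apart, not_false_eq_true, or_self, not_exists, not_lt]
  exact fun i => (lo_lt_hi _ _).le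

theorem refines_whole (a : LeanBox n) : Refines a whole := by
  cases a <;> trivial

theorem apart_mono (a b c : LeanBox n) (h : Refines a b) (hc : Apart c b) : Apart c a := by
  rcases a with _ | ⟨s, k⟩ <;> rcases b with _ | ⟨t, l⟩ <;> rcases c with _ | ⟨u, r⟩ <;>
    simp only [Apart, Refines] at h hc ⊢
  obtain ⟨i, hi | hi⟩ := hc
  · exact ⟨i, Or.inl (hi.trans_le (h i).1)⟩
  · exact ⟨i, Or.inr ((h i).2.trans_lt hi)⟩

theorem refines_refl (a : LeanBox n) : Refines a a := by
  rcases a with _ | ⟨s, k⟩ <;> simp [Refines]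

theorem refines_trans (a b c : LeanBox n) (h : Refines a b) (h' : Refines b c) :
    Refines a c := by
  rcases a with _ | ⟨s, k⟩ <;> rcases b with _ | ⟨t, l⟩ <;> rcases c with _ | ⟨u, r⟩ <;>
    simp only [Refines] at h h' ⊢
  exact fun i => ⟨(h' i).1.trans (h i).1, (h i).2.trans (h' i).2⟩

theorem cube_refines_iff {t d : ℕ} {k l : Fin n → ℤ} :
    Refines (cube (t + d) k) (cube t l) ↔
      ∀ i, l i * 2 ^ d ≤ k i ∧ k i + 2 ≤ (l i + 2) * 2 ^ d := by
  simp only [Refines, lo, hi]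
  refine forall_congr' fun i => and_congr ?_ ?_
  · rw [div_le_div_iff₀ (by positivity) (by positivity), pow_add, ← mul_assoc, mul_right_comm,
      mul_le_mul_iff_left₀ (by positivity)]
    exact_mod_cast Iff.rfl
  · rw [div_le_div_iff₀ (by positivity) (by positivity), pow_add, ← mul_assoc,
      mul_right_comm ((l i : ℚ) + 2), mul_le_mul_iff_left₀ (by positivity)]
    exact_mod_cast Iff.rfl

theorem level_le [NeZero n] {s t : ℕ} {k l : Fin n → ℤ} (h : Refines (cube s k) (cube t l)) :
    t ≤ s := by
  have h0 := h 0
  rw [hi_eq, hi_eq] at h0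
  have h1 : (2 : ℚ) / 2 ^ s ≤ 2 / 2 ^ t := by linarith
  rw [div_le_div_iff_of_pos_left (by norm_num) (by positivity) (by positivity)] at h1
  exact (pow_le_pow_iff_right₀ (by norm_num)).1 h1

theorem eq_of_refines_same {s : ℕ} {k l : Fin n → ℤ} (h : Refines (cube s k) (cube s l)) :
    k = l := by
  have h' := (cube_refines_iff (t := s) (d := 0)).1 h
  funext i
  have := h' i
  simp only [pow_zero, mul_one] at this
  omega

theorem refines_antisymm [NeZero n] (a b : LeanBox n) (h : Refines a b) (h' : Refines b a) :
    a = b := by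
  rcases a with _ | ⟨s, k⟩ <;> rcases b with _ | ⟨t, l⟩
  · rfl
  · exact h.elim
  · exact h'.elim
  · obtain rfl : s = t := le_antisymm (level_le h') (level_le h)
    rw [eq_of_refines_same h]

end LeanBox

/-- The pre-natural space of lean dyadic boxes of dimension `n ≥ 1`. -/
def leanPre (n : ℕ) [NeZero n] : PreNaturalSpace where
  Dot := LeanBox n
  countable := LeanBox.nonempty_equiv
  Apart := LeanBox.Apart
  Refines := LeanBox.Refines
  decApart := LeanBox.decApart
  decRefines := LeanBox.decRefines
  apart_comm := LeanBox.apart_comm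
  apart_irrefl := LeanBox.apart_irrefl
  apart_mono := LeanBox.apart_mono
  refines_refl := LeanBox.refines_refl
  refines_trans := LeanBox.refines_trans
  refines_antisymm := LeanBox.refines_antisymm

namespace LeanBox

variable {n : ℕ}

/-- The grade of a box in the trea of lean dyadic boxes. -/
def grade : LeanBox n → ℕ
  | whole => 0
  | cube s _ => s + 1

theorem grade_lt [NeZero n] {a b : LeanBox n} (h : (leanPre n).StrictRefines a b) :
    grade b < grade a := by
  obtain ⟨h, hne⟩ := h
  change Refines a b at h
  rcases a with _ | ⟨s, k⟩ <;> rcases b with _ | ⟨t, l⟩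
  · exact (hne rfl).elim
  · exact h.elim
  · simp [grade]
  · have hts := level_le h
    rcases hts.eq_or_lt with rfl | hlt
    · exact (hne (by rw [eq_of_refines_same h])).elim
    · simpa [grade] using hlt

theorem exists_between {t d : ℕ} {k l : Fin n → ℤ}
    (h : Refines (cube (t + (d + 1)) k) (cube t l)) :
    ∃ l', Refines (cube (t + (d + 1)) k) (cube (t + 1) l') ∧
      Refines (cube (t + 1) l') (cube t l) := by
  rw [cube_refines_iff] at h
  refine ⟨fun i => min (k i / 2 ^ d) (2 * l i + 2), ?_, ?_⟩
  · rw [show t + (d + 1) = t + 1 + d by ring, cube_refines_iff]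
    intro i
    have hD : (1 : ℤ) ≤ 2 ^ d := one_le_pow₀ (by norm_num)
    obtain ⟨h1, h2⟩ := h i
    rw [pow_succ] at h1 h2
    have h3 := Int.ediv_mul_le (k i) (show (2 : ℤ) ^ d ≠ 0 by positivity)
    have h4 := Int.lt_ediv_add_one_mul_self (k i) (show (0 : ℤ) < 2 ^ d by positivity)
    refine ⟨(mul_le_mul_of_nonneg_right (min_le_left _ _) (by positivity)).trans h3, ?_⟩
    rcases min_choice (k i / 2 ^ d) (2 * l i + 2) with h5 | h5 <;> simp only [h5] <;> nlinarith
  · rw [cube_refines_iff]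
    intro i
    obtain ⟨h1, h2⟩ := h i
    rw [pow_succ] at h1 h2
    have h6 : 2 * l i ≤ k i / 2 ^ d :=
      (Int.le_ediv_iff_mul_le (by positivity)).2 (by linarith)
    have h7 := min_le_right (k i / 2 ^ d) (2 * l i + 2)
    have h8 : 2 * l i ≤ min (k i / 2 ^ d) (2 * l i + 2) := le_min h6 (by linarith)
    constructor <;> linarith

theorem exists_unit (s : ℕ) (k : Fin n → ℤ) : ∃ l, Refines (cube s k) (cube 0 l) := by
  refine ⟨fun i => k i / 2 ^ s, ?_⟩
  have h := cube_refines_iff (t := 0) (d := s) (k := k) (l := fun i => k i / 2 ^ s)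
  rw [zero_add] at h
  refine h.2 fun i => ?_
  have hD : (1 : ℤ) ≤ 2 ^ s := one_le_pow₀ (by norm_num)
  have h3 := Int.ediv_mul_le (k i) (show (2 : ℤ) ^ s ≠ 0 by positivity)
  have h4 := Int.lt_ediv_add_one_mul_self (k i) (show (0 : ℤ) < 2 ^ s by positivity)
  exact ⟨h3, by nlinarith⟩

theorem grade_succ [NeZero n] {a c : LeanBox n} (h : (leanPre n).Succ a c) :
    grade a = grade c + 1 := by
  have hlt := grade_lt h.1
  obtain ⟨⟨h1, -⟩, h2⟩ := h
  change Refines a c at h1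
  rcases a with _ | ⟨s, k⟩ <;> rcases c with _ | ⟨t, l⟩
  · simp [grade] at hlt
  · exact h1.elim
  · obtain ⟨l, hl⟩ := exists_unit s k
    by_contra hne
    have := h2 (cube 0 l) ⟨hl, fun e => hne ?_⟩ (refines_whole (cube 0 l))
    · cases this
    · cases e
      rfl
  · simp only [grade] at hlt ⊢
    obtain ⟨d, rfl⟩ : ∃ d, s = t + (d + 1) := ⟨s - t - 1, by omega⟩
    obtain ⟨l', h3, h4⟩ := exists_between h1
    by_contra hne
    have := h2 (cube (t + 1) l') ⟨h3, fun e => hne ?_⟩ h4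
    · injection this with h5
      omega
    · injection e with h5
      omega

theorem finite_refines [NeZero n] (a : LeanBox n) : {b : LeanBox n | Refines a b}.Finite := by
  rcases a with _ | ⟨s, k⟩
  · refine (Set.finite_singleton whole).subset ?_
    rintro (_ | ⟨t, l⟩) h
    · rfl
    · exact h.elim
  · have hf : ((Set.Iic s) ×ˢ (Set.Icc (fun i => -|k i| - 2) (fun i => |k i| + 2))).Finite :=
      (Set.finite_Iic s).prod (Set.finite_Icc (fun i => -|k i| - 2) (fun i => |k i| + 2))
    refine ((hf.image fun q => cube q.1 q.2).insert whole).subset ?_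
    rintro (_ | ⟨t, l⟩) h
    · exact Set.mem_insert _ _
    · refine Set.mem_insert_of_mem _ ⟨(t, l), ⟨level_le h, ?_⟩, rfl⟩
      obtain ⟨d, rfl⟩ : ∃ d, s = t + d := ⟨s - t, by have := level_le h; omega⟩
      have h' := cube_refines_iff.1 h
      have hD : (1 : ℤ) ≤ 2 ^ d := one_le_pow₀ (by norm_num)
      refine ⟨fun i => ?_, fun i => ?_⟩
      · obtain ⟨h1, h2⟩ := h' i
        have h3 := neg_abs_le (k i)
        have h4 := abs_nonneg (k i)
        change -|k i| - 2 ≤ l i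
        by_contra! hc
        nlinarith
      · obtain ⟨h1, h2⟩ := h' i
        have h3 := le_abs_self (k i)
        have h4 := abs_nonneg (k i)
        change l i ≤ |k i| + 2
        by_contra! hc
        nlinarith

/-- A strictly shrinking sequence of lean dyadic boxes is a point. -/
theorem isPoint_of_strict [NeZero n] (p : ℕ → LeanBox n)
    (h : ∀ j, (leanPre n).StrictRefines (p (j + 1)) (p j)) : (leanPre n).IsPoint p := by
  refine ⟨fun j => ⟨(h j).1, j + 1, h j⟩, fun a b hab => ?_⟩
  have hg : ∀ j, j ≤ grade (p j) := by
    intro j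
    induction j with
    | zero => exact Nat.zero_le _
    | succ j ih => have := grade_lt (h j); omega
  have key : ∀ a b : LeanBox n, ∀ i s t k l, a = cube s k → b = cube t l →
      hi s (k i) < lo t (l i) → ∃ m, Apart (p m) a ∨ Apart (p m) b := by
    rintro _ _ i s t k l rfl rfl hlt
    obtain ⟨N, hN⟩ := exists_pow_lt_of_lt_one (show 0 < (lo t (l i) - hi s (k i)) / 2 by linarith)
      (show (1 / 2 : ℚ) < 1 by norm_num)
    refine ⟨N + 1, ?_⟩
    have hN1 := hg (N + 1)
    cases hp : p (N + 1) with
    | whole => rw [hp] at hN1; simp [grade] at hN1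
    | cube u r =>
      rw [hp] at hN1
      simp only [grade] at hN1
      have h1 : ((1 : ℚ) / 2) ^ u ≤ (1 / 2) ^ N :=
        pow_le_pow_of_le_one (by norm_num) (by norm_num) (by omega)
      have h2 := hi_eq u (r i)
      rw [one_div, inv_pow] at h1
      rw [div_eq_mul_inv] at h2
      by_cases h3 : hi s (k i) < lo u (r i)
      · exact Or.inl ⟨i, Or.inr h3⟩
      · refine Or.inr ⟨i, Or.inl ?_⟩
        linarith
  rcases a with _ | ⟨s, k⟩ <;> rcases b with _ | ⟨t, l⟩
  · exact False.elim hab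
  · exact False.elim hab
  · exact False.elim hab
  · obtain ⟨i, hi | hi⟩ := hab
    · exact key _ _ i s t k l rfl rfl hi
    · obtain ⟨m, hm⟩ := key _ _ i t s l k rfl rfl hi
      exact ⟨m, hm.symm⟩

theorem cube_strict [NeZero n] {s : ℕ} {k l : Fin n → ℤ}
    (h : ∀ i, 2 * k i ≤ l i ∧ l i ≤ 2 * k i + 2) :
    (leanPre n).StrictRefines (cube (s + 1) l) (cube s k) := by
  refine ⟨cube_refines_iff.2 fun i => ?_, fun e => ?_⟩
  · obtain ⟨h1, h2⟩ := h i
    constructor <;> linarith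
  · injection e with h5
    omega

theorem exists_point [NeZero n] (a : LeanBox n) :
    ∃ p : (leanPre n).Point, (leanPre n).BelongsTo p a := by
  have hs : ∀ (s : ℕ) (k : Fin n → ℤ), ∀ j, (leanPre n).StrictRefines
      (cube (s + (j + 1)) fun i => k i * 2 ^ (j + 1)) (cube (s + j) fun i => k i * 2 ^ j) := by
    intro s k j
    refine cube_strict fun i => ?_
    rw [pow_succ]
    constructor <;> linarith
  rcases a with _ | ⟨s, k⟩
  · exact ⟨⟨fun j => cube (0 + j) fun i => (0 : Fin n → ℤ) i * 2 ^ j,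
      isPoint_of_strict _ (hs 0 0)⟩, 0, (trivial : Refines (cube (0 + 0) fun i => (0 : Fin n → ℤ) i * 2 ^ 0) whole),
      fun e => by cases e⟩
  · refine ⟨⟨fun j => cube (s + j) fun i => k i * 2 ^ j, isPoint_of_strict _ (hs s k)⟩, 1, ?_⟩
    simpa using hs s k 0

theorem hasSuccTrail_length [NeZero n] (a : LeanBox n) (j : ℕ)
    (h : (leanPre n).HasSuccTrail j (whole : LeanBox n) a) : j = grade a := by
  obtain ⟨b, h0, hj, hb⟩ := h
  have hg : ∀ i ≤ j, grade (b i) = i := by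
    intro i
    induction i with
    | zero => intro _; rw [h0]; rfl
    | succ i ih => intro hi; rw [grade_succ (hb i (by omega)), ih (by omega)]
  rw [← hj, hg j le_rfl]

end LeanBox

/-- The lean spraid representation of `ℝⁿ`, `n ≥ 1`, built from lean dyadic boxes. -/
def leanSpraid (n : ℕ) [NeZero n] : Spraid where
  toPreNaturalSpace := leanPre n
  maxDot := LeanBox.whole
  refines_maxDot := LeanBox.refines_whole
  exists_point := LeanBox.exists_point
  isTrea := ⟨LeanBox.finite_refines, LeanBox.grade, LeanBox.hasSuccTrail_length⟩
  isPoint_of_strict := LeanBox.isPoint_of_strict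

section Value

variable {n : ℕ}

theorem LeanBox.toSet_mono {a b : LeanBox n} (h : LeanBox.Refines a b) : a.toSet ⊆ b.toSet := by
  rcases a with _ | ⟨s, k⟩ <;> rcases b with _ | ⟨t, l⟩
  · exact subset_rfl
  · exact h.elim
  · exact Set.subset_univ _
  · intro x hx i
    have h1 : ((LeanBox.lo t (l i) : ℚ) : ℝ) ≤ (LeanBox.lo s (k i) : ℚ) := by exact_mod_cast (h i).1
    have h2 : ((LeanBox.hi s (k i) : ℚ) : ℝ) ≤ (LeanBox.hi t (l i) : ℚ) := by exact_mod_cast (h i).2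
    exact ⟨h1.trans (hx i).1, (hx i).2.trans h2⟩

theorem LeanBox.toSet_nonempty (a : LeanBox n) : a.toSet.Nonempty := by
  rcases a with _ | ⟨s, k⟩
  · exact ⟨0, trivial⟩
  · refine ⟨WithLp.toLp 2 fun i => ((LeanBox.lo s (k i) : ℚ) : ℝ), fun i => ⟨le_rfl, ?_⟩⟩
    exact Rat.cast_le.2 (LeanBox.lo_lt_hi s (k i)).le

theorem LeanBox.isCompact_cube (s : ℕ) (k : Fin n → ℤ) :
    IsCompact (LeanBox.cube s k).toSet := by
  have h : IsCompact (Set.Icc (fun i => ((LeanBox.lo s (k i) : ℚ) : ℝ))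
      (fun i => ((LeanBox.hi s (k i) : ℚ) : ℝ))) := isCompact_Icc
  have h' := h.image (PiLp.continuous_toLp 2 (fun _ : Fin n => ℝ))
  convert h' using 1
  ext x
  constructor
  · intro hx
    exact ⟨WithLp.ofLp x, ⟨fun i => (hx i).1, fun i => (hx i).2⟩, rfl⟩
  · rintro ⟨y, hy, rfl⟩ i
    exact ⟨hy.1 i, hy.2 i⟩

theorem LeanBox.isClosed_toSet (a : LeanBox n) : IsClosed a.toSet := by
  rcases a with _ | ⟨s, k⟩
  · exact isClosed_univ
  · exact (LeanBox.isCompact_cube s k).isClosed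

theorem point_refines [NeZero n] (p : (leanPre n).Point) {i j : ℕ} (h : i ≤ j) :
    LeanBox.Refines (p.1 j) (p.1 i) := by
  induction j, h using Nat.le_induction with
  | base => exact LeanBox.refines_refl _
  | succ j _ ih => exact LeanBox.refines_trans _ _ _ (p.2.1 j).1 ih

theorem exists_grade [NeZero n] (p : (leanPre n).Point) (N : ℕ) : ∃ m, ∀ j ≥ m, N ≤ LeanBox.grade (p.1 j) := by
  have h1 : ∃ m, N ≤ LeanBox.grade (p.1 m) := by
    induction N with
    | zero => exact ⟨0, Nat.zero_le _⟩
    | succ N ih =>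
      obtain ⟨m, hm⟩ := ih
      obtain ⟨m', hm'⟩ := (p.2.1 m).2
      exact ⟨m', lt_of_le_of_lt hm (LeanBox.grade_lt hm')⟩
  obtain ⟨m, hm⟩ := h1
  refine ⟨m, fun j hj => hm.trans ?_⟩
  by_cases he : p.1 j = p.1 m
  · rw [he]
  · exact (LeanBox.grade_lt ⟨point_refines p hj, he⟩).le

/-- The boxes of a point have a common element. -/
theorem exists_value [NeZero n] (p : (leanPre n).Point) :
    ∃ x : EuclideanSpace ℝ (Fin n), ∀ j, x ∈ LeanBox.toSet (p.1 j) := by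
  obtain ⟨m, hm⟩ := exists_grade p 1
  have hc : IsCompact (LeanBox.toSet (p.1 (m + 0))) := by
    have := hm m le_rfl
    rw [Nat.add_zero]
    cases hp : p.1 m with
    | whole => rw [hp] at this; simp [LeanBox.grade] at this
    | cube s k => exact LeanBox.isCompact_cube s k
  obtain ⟨x, hx⟩ := IsCompact.nonempty_iInter_of_sequence_nonempty_isCompact_isClosed
    (fun j => LeanBox.toSet (p.1 (m + j)))
    (fun j => LeanBox.toSet_mono (point_refines p (by omega)))
    (fun j => LeanBox.toSet_nonempty _) hc (fun j => LeanBox.isClosed_toSet _)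
  refine ⟨x, fun j => ?_⟩
  exact LeanBox.toSet_mono (point_refines p (show j ≤ m + j by omega)) (Set.mem_iInter.1 hx j)

/-- The element of `ℝⁿ` that a point of the lean spraid represents: the common element of its
boxes. -/
noncomputable def value [NeZero n] (p : (leanSpraid n).Point) : EuclideanSpace ℝ (Fin n) :=
  (exists_value p).choose

theorem value_mem [NeZero n] (p : (leanSpraid n).Point) (j : ℕ) :
    value p ∈ LeanBox.toSet (p.1 j) :=
  (exists_value p).choose_spec j

/-- Two points have the same value as soon as they are equivalent. In particular the common element
of the boxes of a point is unique. -/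
theorem eq_of_touch [NeZero n] (p q : (leanSpraid n).Point) (h : (leanSpraid n).PointEquiv p q)
    (x y : EuclideanSpace ℝ (Fin n)) (hx : ∀ j, x ∈ LeanBox.toSet (p.1 j))
    (hy : ∀ j, y ∈ LeanBox.toSet (q.1 j)) : x = y := by
  have key : ∀ i, ∀ N : ℕ, |x i - y i| ≤ 4 * (1 / 2) ^ N := by
    intro i N
    obtain ⟨m, hm⟩ := exists_grade p (N + 1)
    obtain ⟨m', hm'⟩ := exists_grade q (N + 1)
    have h1 := hm (max m m') (le_max_left _ _)
    have h2 := hm' (max m m') (le_max_right _ _)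
    have h3 : ¬ LeanBox.Apart (p.1 (max m m')) (q.1 (max m m')) := fun h' => h ⟨_, h'⟩
    have h4 := hx (max m m')
    have h5 := hy (max m m')
    generalize p.1 (max m m') = a at h1 h3 h4
    generalize q.1 (max m m') = b at h2 h3 h5
    rcases a with _ | ⟨s, k⟩
    · simp [LeanBox.grade] at h1
    rcases b with _ | ⟨t, l⟩
    · simp [LeanBox.grade] at h2
    simp only [LeanBox.grade] at h1 h2
    simp only [LeanBox.Apart, not_exists, not_or, not_lt] at h3
    have h6 : ((LeanBox.lo t (l i) : ℚ) : ℝ) ≤ (LeanBox.hi s (k i) : ℚ) := by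
      exact_mod_cast (h3 i).1
    have h7 : ((LeanBox.lo s (k i) : ℚ) : ℝ) ≤ (LeanBox.hi t (l i) : ℚ) := by
      exact_mod_cast (h3 i).2
    obtain ⟨h8, h9⟩ := h4 i
    obtain ⟨h10, h11⟩ := h5 i
    rw [LeanBox.hi_eq] at h6 h7 h9 h11
    push_cast at h6 h7 h9 h11
    have h12 : ((1 : ℝ) / 2) ^ s ≤ (1 / 2) ^ N :=
      pow_le_pow_of_le_one (by norm_num) (by norm_num) (by omega)
    have h13 : ((1 : ℝ) / 2) ^ t ≤ (1 / 2) ^ N :=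
      pow_le_pow_of_le_one (by norm_num) (by norm_num) (by omega)
    rw [one_div, inv_pow] at h12 h13
    rw [div_eq_mul_inv] at h6 h7 h9 h11
    rw [one_div, abs_le]
    constructor <;> linarith
  ext i
  have hl : Filter.Tendsto (fun N : ℕ => (4 : ℝ) * (1 / 2) ^ N) Filter.atTop (nhds (4 * 0)) :=
    (tendsto_pow_atTop_nhds_zero_of_lt_one (by norm_num) (by norm_num)).const_mul 4
  rw [mul_zero] at hl
  have h0 : |x i - y i| ≤ 0 := ge_of_tendsto' hl (key i)
  exact sub_eq_zero.1 (abs_nonpos_iff.1 h0)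

/-- Points are equivalent exactly when they represent the same element of `ℝⁿ`. -/
theorem value_eq_iff [NeZero n] (p q : (leanSpraid n).Point) :
    value p = value q ↔ (leanSpraid n).PointEquiv p q := by
  refine ⟨?_, fun h => eq_of_touch p q h _ _ (value_mem p) (value_mem q)⟩
  rintro h ⟨j, hj⟩
  have h1 := value_mem p j
  have h2 := value_mem q j
  rw [← h] at h2
  change LeanBox.Apart (p.1 j) (q.1 j) at hj
  generalize value p = x at h1 h2
  generalize p.1 j = a at h1 hj
  generalize q.1 j = b at h2 hj
  rcases a with _ | ⟨s, k⟩
  · exact hj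
  rcases b with _ | ⟨t, l⟩
  · exact hj
  obtain ⟨i, hi | hi⟩ := hj
  · have : ((LeanBox.hi s (k i) : ℚ) : ℝ) < (LeanBox.lo t (l i) : ℚ) := by exact_mod_cast hi
    linarith [(h1 i).2, (h2 i).1]
  · have : ((LeanBox.hi t (l i) : ℚ) : ℝ) < (LeanBox.lo s (k i) : ℚ) := by exact_mod_cast hi
    linarith [(h2 i).2, (h1 i).1]

/-- Every element of `ℝⁿ` is represented by a point of the lean spraid. -/
theorem value_surjective [NeZero n] : Function.Surjective (value (n := n)) := by
  intro x
  have hs : ∀ j, (leanPre n).StrictRefines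
      (LeanBox.cube (j + 1) fun i => ⌊x i * 2 ^ (j + 1)⌋) (LeanBox.cube j fun i => ⌊x i * 2 ^ j⌋) := by
    intro j
    refine LeanBox.cube_strict fun i => ?_
    have h1 := Int.floor_le (x i * 2 ^ j)
    have h2 := Int.lt_floor_add_one (x i * 2 ^ j)
    rw [pow_succ]
    constructor
    · rw [Int.le_floor]
      push_cast
      linarith
    · have h3 := Int.floor_le (x i * (2 ^ j * 2))
      have h4 : ((⌊x i * (2 ^ j * 2)⌋ : ℤ) : ℝ) < ((2 * ⌊x i * 2 ^ j⌋ + 2 : ℤ) : ℝ) := by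
        push_cast
        linarith
      exact (Int.cast_lt.1 h4).le
  let p : (leanSpraid n).Point :=
    ⟨fun j => LeanBox.cube j fun i => ⌊x i * 2 ^ j⌋, LeanBox.isPoint_of_strict _ hs⟩
  refine ⟨p, eq_of_touch p p ?_ _ _ (value_mem p) ?_⟩
  · exact fun ⟨j, hj⟩ => LeanBox.apart_irrefl (p.1 j) hj
  · intro j i
    have h1 := Int.floor_le (x i * 2 ^ j)
    have h2 := Int.lt_floor_add_one (x i * 2 ^ j)
    simp only [LeanBox.lo, LeanBox.hi]
    push_cast
    rw [div_le_iff₀ (by positivity), le_div_iff₀ (by positivity)]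
    exact ⟨h1, by linarith⟩

end Value

/-- Bishop-continuity: uniform continuity on every compact subset. -/
def BishopContinuous {n m : ℕ} (f : EuclideanSpace ℝ (Fin n) → EuclideanSpace ℝ (Fin m)) : Prop :=
  ∀ K : Set (EuclideanSpace ℝ (Fin n)), IsCompact K → UniformContinuousOn f K

end NaturalTopology

/-! Boxes of one level overlap, so a box has several enclosing boxes of each coarser level and no
canonical parent. Choosing separately for each box an image that approximates `f` on it therefore
need not respect refinement. Instead, fix levels `r j` at which `f` oscillates very little on every
box meeting the ball of radius `j`, and let the image of `a` depend only on its milestones: the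
enclosing boxes of the levels `r j` on which the oscillation really is that small. Refining `a` can
only add milestones. If none is added the image is unchanged. If there were `c ≥ 1` and some are
added, the level of the image rises from `3 * c` by at least three, which leaves room for the new
image inside the old one (`around_refines`, `boxMap_refines`). Without milestones the image is the
maximal dot.

The oscillation on the common part of `c` milestones must then be small compared with `1 / 2 ^ (3 *
c)`. At most `2 ^ n` boxes of a given level contain `a`, so if the last stage is `J` then `c ≤ (J +
1) * 2 ^ n`, and the tolerance of stage `J` is fixed in advance for that count
(`abs_sub_le_of_mem_milestoneSet`).

Along a point the number of milestones is unbounded (`exists_le_ncard_milestones`), so its images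
form a point. These images all contain `f` of the value (`map_mem_boxMap`), which is therefore the
value of the image point. Apartness is reflected because equivalence of points is equality of
values. -/

namespace NaturalTopology

namespace LeanBox

variable {n m : ℕ}

/-! ### Enclosing boxes of a given level, and diameters -/

theorem exists_refines_level {s t : ℕ} (h : t ≤ s) (k : Fin n → ℤ) :
    ∃ l, Refines (cube s k) (cube t l) := by
  obtain ⟨d, rfl⟩ := Nat.exists_eq_add_of_le h
  refine ⟨fun i => k i / 2 ^ d, cube_refines_iff.2 fun i => ?_⟩
  have hD : (1 : ℤ) ≤ 2 ^ d := one_le_pow₀ (by norm_num)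
  have h3 := Int.ediv_mul_le (k i) (show (2 : ℤ) ^ d ≠ 0 by positivity)
  have h4 := Int.lt_ediv_add_one_mul_self (k i) (show (0 : ℤ) < 2 ^ d by positivity)
  exact ⟨h3, by nlinarith⟩

/-- In each coordinate a box has at most two enclosing boxes of a given level. -/
theorem mem_Icc_of_refines [NeZero n] {s t : ℕ} {k l : Fin n → ℤ}
    (h : Refines (cube s k) (cube t l)) :
    l ∈ Finset.Icc (fun i => k i / 2 ^ (s - t) - 1) (fun i => k i / 2 ^ (s - t)) := by
  obtain ⟨d, rfl⟩ := Nat.exists_eq_add_of_le (level_le h)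
  rw [Nat.add_sub_cancel_left, Finset.mem_Icc]
  have h' := cube_refines_iff.1 h
  refine ⟨fun i => ?_, fun i => (Int.le_ediv_iff_mul_le (by positivity)).2 (h' i).1⟩
  have h2 : k i / 2 ^ d < l i + 2 :=
    (Int.ediv_lt_iff_lt_mul (by positivity)).2 (by linarith [(h' i).2])
  change k i / 2 ^ d - 1 ≤ l i
  omega

theorem abs_sub_le_of_mem {s : ℕ} {k : Fin n → ℤ} {x y : EuclideanSpace ℝ (Fin n)}
    (hx : x ∈ (cube s k).toSet) (hy : y ∈ (cube s k).toSet) (i : Fin n) :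
    |x i - y i| ≤ 2 / 2 ^ s := by
  have h1 := hx i
  have h2 := hy i
  rw [hi_eq] at h1 h2
  push_cast at h1 h2
  rw [abs_le]
  constructor <;> linarith [h1.1, h1.2, h2.1, h2.2]

theorem dist_le_of_mem {s : ℕ} {k : Fin n → ℤ} {x y : EuclideanSpace ℝ (Fin n)}
    (hx : x ∈ (cube s k).toSet) (hy : y ∈ (cube s k).toSet) :
    dist x y ≤ n * 2 * (1 / 2) ^ s := by
  -- The crude comparison with the `ℓ¹` distance suffices: only convergence of the diameters to `0`
  -- is needed.
  have h : dist x y ≤ ∑ i, |x i - y i| := by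
    rw [EuclideanSpace.dist_eq]
    refine (Real.sqrt_le_left (Finset.sum_nonneg fun i _ => abs_nonneg _)).2 ?_
    simp only [Real.dist_eq]
    exact Finset.sum_sq_le_sq_sum_of_nonneg fun i _ => abs_nonneg _
  refine h.trans ((Finset.sum_le_sum fun i _ => abs_sub_le_of_mem hx hy i).trans (le_of_eq ?_))
  rw [Finset.sum_const, Finset.card_univ, Fintype.card_fin, nsmul_eq_mul, one_div, inv_pow]
  ring

/-! ### Boxes centred around a given element -/

/-- A box of level `t` in which `y` lies centrally: at distance at least `1 / 2 ^ (t + 1)` from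
every face. -/
noncomputable def around (t : ℕ) (y : EuclideanSpace ℝ (Fin m)) : LeanBox m :=
  cube t fun i => ⌊y i * 2 ^ t - 1 / 2⌋

theorem lo_around_le (t : ℕ) (u : ℝ) :
    ((lo t ⌊u * 2 ^ t - 1 / 2⌋ : ℚ) : ℝ) ≤ u - (1 / 2) / 2 ^ t := by
  simp only [lo]
  push_cast
  rw [div_le_iff₀ (by positivity), sub_mul, div_mul_cancel₀ _ (by positivity)]
  exact Int.floor_le _

theorem le_lo_around (t : ℕ) (u : ℝ) :
    u - (3 / 2) / 2 ^ t ≤ ((lo t ⌊u * 2 ^ t - 1 / 2⌋ : ℚ) : ℝ) := by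
  simp only [lo]
  push_cast
  rw [le_div_iff₀ (by positivity), sub_mul, div_mul_cancel₀ _ (by positivity)]
  linarith [Int.lt_floor_add_one (u * 2 ^ t - 1 / 2)]

theorem le_hi_around (t : ℕ) (u : ℝ) :
    u + (1 / 2) / 2 ^ t ≤ ((hi t ⌊u * 2 ^ t - 1 / 2⌋ : ℚ) : ℝ) := by
  have := le_lo_around t u
  rw [hi_eq]
  push_cast
  have e : (2 : ℝ) / 2 ^ t = (1 / 2) / 2 ^ t + (3 / 2) / 2 ^ t := by ring
  linarith

theorem hi_around_le (t : ℕ) (u : ℝ) :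
    ((hi t ⌊u * 2 ^ t - 1 / 2⌋ : ℚ) : ℝ) ≤ u + (3 / 2) / 2 ^ t := by
  have := lo_around_le t u
  rw [hi_eq]
  push_cast
  have e : (2 : ℝ) / 2 ^ t = (1 / 2) / 2 ^ t + (3 / 2) / 2 ^ t := by ring
  linarith

theorem mem_around {t : ℕ} {x y : EuclideanSpace ℝ (Fin m)}
    (h : ∀ i, |x i - y i| ≤ (1 / 4) / 2 ^ t) : x ∈ (around t y).toSet := by
  intro i
  have h1 := abs_le.1 (h i)
  have h2 := lo_around_le t (y i)
  have h3 := le_hi_around t (y i)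
  have e : ((1 : ℝ) / 2) / 2 ^ t = (1 / 4) / 2 ^ t + (1 / 4) / 2 ^ t := by ring
  have h4 : (0 : ℝ) ≤ (1 / 4) / 2 ^ t := by positivity
  constructor <;> linarith

/-- In units of `1 / 2 ^ t`, the small box reaches at most `3 / 16` beyond `x` and `x` is within `1
/ 4` of `y`, while the large box has margin `1 / 2` around `y`. Two extra levels would only give `3
/ 8 + 1 / 4 > 1 / 2`; hence the factor `3` in the levels of `boxMap`. -/
theorem around_refines {s t : ℕ} (hst : t + 3 ≤ s) {x y : EuclideanSpace ℝ (Fin m)}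
    (h : ∀ i, |x i - y i| ≤ (1 / 4) / 2 ^ t) : Refines (around s x) (around t y) := by
  intro i
  have h1 := abs_le.1 (h i)
  have h2 := lo_around_le t (y i)
  have h3 := le_hi_around t (y i)
  have h4 := le_lo_around s (x i)
  have h5 := hi_around_le s (x i)
  have h6 : (3 / 2 : ℝ) / 2 ^ s ≤ (1 / 4) / 2 ^ t := by
    have h7 : (2 : ℝ) ^ (t + 3) ≤ 2 ^ s := pow_le_pow_right₀ (by norm_num) hst
    rw [pow_add] at h7
    rw [div_le_div_iff₀ (by positivity) (by positivity)]
    have h8 : (0 : ℝ) < 2 ^ t := by positivity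
    linarith
  have e : ((1 : ℝ) / 2) / 2 ^ t = (1 / 4) / 2 ^ t + (1 / 4) / 2 ^ t := by ring
  constructor
  · rw [← Rat.cast_le (K := ℝ)]
    linarith
  · rw [← Rat.cast_le (K := ℝ)]
    linarith

/-! ### Criteria for a sequence of boxes to be a point -/

/-- A shrinking sequence of lean dyadic boxes that shrinks strictly infinitely often is a point. -/
theorem isPoint_of_shrinking [NeZero n] (p : ℕ → LeanBox n)
    (h : ∀ j, Refines (p (j + 1)) (p j) ∧ ∃ l, (leanPre n).StrictRefines (p l) (p j)) :
    (leanPre n).IsPoint p := by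
  refine ⟨h, fun a b hab => ?_⟩
  choose φ hφ using fun j => (h j).2
  -- Iterating `φ` selects boxes that shrink strictly at every step, and these already decide
  -- between `a` and `b`.
  obtain ⟨j, hj⟩ := (isPoint_of_strict (fun j => p (φ^[j] 0)) fun j => by
    rw [Function.iterate_succ_apply']
    exact hφ _).2 a b hab
  exact ⟨_, hj⟩

theorem isPoint_of_grade_unbounded [NeZero n] (p : ℕ → LeanBox n)
    (h : ∀ i j, i ≤ j → Refines (p j) (p i)) (hg : ∀ N, ∃ j, N ≤ grade (p j)) :
    (leanPre n).IsPoint p := by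
  refine isPoint_of_shrinking p fun j => ⟨h _ _ j.le_succ, ?_⟩
  obtain ⟨l, hl⟩ := hg (grade (p j) + 1)
  have hne : p l ≠ p j := fun e => by rw [e] at hl; omega
  refine ⟨l, ?_, hne⟩
  rcases le_total j l with hjl | hlj
  · exact h _ _ hjl
  · have := grade_lt (n := n) ⟨h _ _ hlj, hne.symm⟩
    omega

end LeanBox

open LeanBox

/-! ### Milestones and their number -/

section Milestones

variable {n m : ℕ} (f : EuclideanSpace ℝ (Fin n) → EuclideanSpace ℝ (Fin m)) (r : ℕ → ℕ)

/-- The oscillation bound of stage `j`; small enough for `3 * c` binary digits whenever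
`c ≤ (j + 1) * 2 ^ n`. -/
noncomputable def stageBound (n j : ℕ) : ℝ := (1 / 4) / 2 ^ (3 * ((j + 1) * 2 ^ n))

/-- The pairs `(j, l)` for which the box of level `r j` with index `l` contains `a`, and on which
`f` has oscillation at most `stageBound n j`. -/
def milestones (a : LeanBox n) : Set (ℕ × (Fin n → ℤ)) :=
  {q | Refines a (cube (r q.1) q.2) ∧ ∀ x ∈ (cube (r q.1) q.2).toSet,
    ∀ y ∈ (cube (r q.1) q.2).toSet, ∀ i, |f x i - f y i| ≤ stageBound n q.1}

theorem milestones_anti {a b : LeanBox n} (h : Refines a b) :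
    milestones f r b ⊆ milestones f r a :=
  fun _ hq => ⟨refines_trans _ _ _ h hq.1, hq.2⟩

theorem milestones_whole : milestones f r (whole : LeanBox n) = ∅ :=
  Set.eq_empty_of_forall_notMem fun _ hq => hq.1

/-- Each of the `J + 1` stages contributes at most two indices per coordinate, by
`mem_Icc_of_refines`. This is the count that `stageBound` anticipates. -/
theorem exists_finset_milestones [NeZero n] (a : LeanBox n) (J : ℕ)
    (hJ : ∀ q ∈ milestones f r a, q.1 ≤ J) :
    ∃ F : Finset (ℕ × (Fin n → ℤ)), milestones f r a ⊆ F ∧ F.card ≤ (J + 1) * 2 ^ n := by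
  classical
  rcases a with _ | ⟨s, k⟩
  · exact ⟨∅, by simp [milestones_whole], by simp⟩
  · refine ⟨(Finset.range (J + 1)).biUnion fun j => ({j} : Finset ℕ) ×ˢ
      Finset.Icc (fun i => k i / 2 ^ (s - r j) - 1) (fun i => k i / 2 ^ (s - r j)), ?_, ?_⟩
    · rintro ⟨j, l⟩ hq
      have := hJ _ hq
      simp only [Finset.coe_biUnion, Set.mem_iUnion]
      refine ⟨j, by simpa [Nat.lt_succ_iff] using this, ?_⟩
      rw [Finset.mem_coe, Finset.mem_product]
      exact ⟨Finset.mem_singleton_self j, mem_Icc_of_refines hq.1⟩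
    · refine (Finset.card_biUnion_le_card_mul _ _ (2 ^ n) fun j _ => ?_).trans (by simp)
      rw [Finset.card_product, Pi.card_Icc]
      simp

variable {r}

/-- A milestone of stage `j` has level `r j ≥ j`, which cannot exceed the level of `a`. Finiteness
makes `ncard` a genuine count rather than the default `0`. -/
theorem finite_milestones [NeZero n] (hr : ∀ j, j ≤ r j) (a : LeanBox n) :
    (milestones f r a).Finite := by
  obtain ⟨F, hF, -⟩ := exists_finset_milestones f r a (grade a) fun q hq => by
    rcases a with _ | ⟨s, k⟩
    · rw [milestones_whole] at hq
      exact hq.elim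
    · have := level_le hq.1
      have := hr q.1
      simp only [LeanBox.grade]
      omega
  exact F.finite_toSet.subset hF

variable (r) in
/-- The common part of the boxes of a set of milestones. -/
def milestoneSet (P : Set (ℕ × (Fin n → ℤ))) : Set (EuclideanSpace ℝ (Fin n)) :=
  {x | ∀ q ∈ P, x ∈ (cube (r q.1) q.2).toSet}

theorem toSet_subset_milestoneSet (a : LeanBox n) :
    a.toSet ⊆ milestoneSet r (milestones f r a) :=
  fun _ hx _ hq => toSet_mono hq.1 hx

/-- A milestone of greatest stage alone gives the bound: its tolerance allows for as many milestones
as can exist up to its stage. -/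
theorem abs_sub_le_of_mem_milestoneSet [NeZero n] (hr : ∀ j, j ≤ r j) {a : LeanBox n}
    (hne : (milestones f r a).Nonempty) {x y : EuclideanSpace ℝ (Fin n)}
    (hx : x ∈ milestoneSet r (milestones f r a)) (hy : y ∈ milestoneSet r (milestones f r a))
    (i : Fin m) : |f x i - f y i| ≤ (1 / 4) / 2 ^ (3 * (milestones f r a).ncard) := by
  obtain ⟨q, hq, hmax⟩ := (finite_milestones f hr a).exists_maximalFor Prod.fst _ hne
  have hle : ∀ q' ∈ milestones f r a, q'.1 ≤ q.1 := fun q' hq' =>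
    (le_total q'.1 q.1).elim id fun h => hmax hq' h
  obtain ⟨F, hF, hcard⟩ := exists_finset_milestones f r a q.1 hle
  have hc : (milestones f r a).ncard ≤ (q.1 + 1) * 2 ^ n := by
    refine le_trans ?_ hcard
    rw [← Set.ncard_coe_finset]
    exact Set.ncard_le_ncard hF F.finite_toSet
  refine (hq.2 x (hx q hq) y (hy q hq) i).trans ?_
  unfold stageBound
  gcongr
  norm_num

/-! ### The map on boxes -/

variable (r) in
open Classical in
/-- The box map of `f`: the level of the image of `a` is governed by the number of milestones
of `a`. -/
noncomputable def boxMap (a : LeanBox n) : LeanBox m :=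
  if (milestones f r a).Nonempty then
    around (3 * (milestones f r a).ncard)
      -- The chosen element depends on the set of milestones only, so boxes with equal milestones
      -- get equal images; it need not lie in `a`.
      (f (Classical.epsilon (· ∈ milestoneSet r (milestones f r a))))
  else whole

theorem epsilon_mem_milestoneSet (a : LeanBox n) :
    Classical.epsilon (· ∈ milestoneSet r (milestones f r a)) ∈
      milestoneSet r (milestones f r a) :=
  Classical.epsilon_spec (p := (· ∈ milestoneSet r (milestones f r a)))
    (a.toSet_nonempty.mono (toSet_subset_milestoneSet f a))

theorem map_mem_boxMap [NeZero n] (hr : ∀ j, j ≤ r j) {a : LeanBox n}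
    {x : EuclideanSpace ℝ (Fin n)} (hx : x ∈ a.toSet) : f x ∈ (boxMap f r a).toSet := by
  unfold boxMap
  split_ifs with hne
  · exact mem_around fun i => abs_sub_le_of_mem_milestoneSet f hr hne
      (toSet_subset_milestoneSet f a hx) (epsilon_mem_milestoneSet f a) i
  · trivial

theorem boxMap_refines [NeZero n] (hr : ∀ j, j ≤ r j) {a b : LeanBox n} (h : Refines a b) :
    Refines (boxMap f r a) (boxMap f r b) := by
  have hsub := milestones_anti f r h
  rcases hsub.eq_or_ssubset with heq | hss
  · unfold boxMap
    rw [heq]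
    exact refines_refl _
  by_cases hb : (milestones f r b).Nonempty
  · have hlt := Set.ncard_lt_ncard hss (finite_milestones f hr a)
    unfold boxMap
    rw [if_pos hb, if_pos (hb.mono hsub)]
    refine around_refines (by omega) fun i => abs_sub_le_of_mem_milestoneSet f hr hb ?_
      (epsilon_mem_milestoneSet f b) i
    -- The element chosen for `a` satisfies more constraints than the one for `b`, so both lie in
    -- the common part for `b`, where `f` oscillates little.
    exact fun q hq => epsilon_mem_milestoneSet f a q (hsub hq)
  · conv => rw [boxMap.eq_def f r b]
    rw [if_neg hb]
    exact refines_whole _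

theorem ncard_milestones_le_grade [NeZero n] (a : LeanBox n) :
    (milestones f r a).ncard ≤ grade (boxMap f r a) := by
  unfold boxMap
  split_ifs with hne
  · simp only [around, LeanBox.grade]
    omega
  · rw [Set.not_nonempty_iff_eq_empty.1 hne, Set.ncard_empty]
    exact Nat.zero_le _

/-! ### Unbounded growth of the milestones along a point -/

/-- A Bishop-continuous function has small oscillation on all sufficiently fine boxes that meet a
given ball. -/
theorem BishopContinuous.exists_level {f : EuclideanSpace ℝ (Fin n) → EuclideanSpace ℝ (Fin m)}
    (hf : BishopContinuous f) (j : ℕ) {ε : ℝ} (hε : 0 < ε) :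
    ∃ s, j ≤ s ∧ ∀ l, (∃ z ∈ (cube s l).toSet, ‖z‖ ≤ j) → ∀ x ∈ (cube s l).toSet,
      ∀ y ∈ (cube s l).toSet, ∀ i, |f x i - f y i| ≤ ε := by
  obtain ⟨δ, hδ, h⟩ := Metric.uniformContinuousOn_iff.1
    -- Boxes of diameter at most `1` that meet the ball of radius `j` stay inside this larger ball.
    (hf _ (isCompact_closedBall (0 : EuclideanSpace ℝ (Fin n)) (j + 1))) ε hε
  have hl : Filter.Tendsto (fun s : ℕ => (n * 2 : ℝ) * (1 / 2) ^ s) Filter.atTop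
      (nhds (n * 2 * 0)) :=
    (tendsto_pow_atTop_nhds_zero_of_lt_one (by norm_num) (by norm_num)).const_mul _
  rw [mul_zero] at hl
  obtain ⟨s, hs, hjs⟩ := ((hl.eventually_lt_const (lt_min hδ one_pos)).and
    (Filter.eventually_ge_atTop j)).exists
  refine ⟨s, hjs, ?_⟩
  rintro l ⟨z, hz, hzj⟩ x hx y hy i
  have hball : ∀ w ∈ (cube s l).toSet, w ∈ Metric.closedBall 0 ((j : ℝ) + 1) := by
    intro w hw
    have h1 := (dist_le_of_mem hw hz).trans (hs.le.trans (min_le_right _ _))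
    have h2 := dist_triangle w z 0
    rw [dist_zero_right z] at h2
    rw [Metric.mem_closedBall]
    linarith
  have h1 := h x (hball x hx) y (hball y hy)
    ((dist_le_of_mem hx hy).trans_lt (hs.trans_le (min_le_left _ _)))
  refine le_trans ?_ h1.le
  rw [dist_eq_norm, ← Real.norm_eq_abs]
  exact PiLp.norm_apply_le (f x - f y) i

/-- Once `j₀` bounds the norm of the value, every stage from `j₀` on yields a milestone as soon as
the box is fine enough. -/
theorem exists_le_ncard_milestones [NeZero n] (hr : ∀ j, j ≤ r j)
    (h : ∀ j l, (∃ z ∈ (cube (r j) l).toSet, ‖z‖ ≤ j) → ∀ x ∈ (cube (r j) l).toSet,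
      ∀ y ∈ (cube (r j) l).toSet, ∀ i, |f x i - f y i| ≤ stageBound n j)
    (p : (leanPre n).Point) (N : ℕ) : ∃ j, N ≤ (milestones f r (p.1 j)).ncard := by
  obtain ⟨x, hx⟩ := exists_value p
  obtain ⟨j₀, hj₀⟩ := exists_nat_ge ‖x‖
  -- The sum dominates each of the `N` levels, as `r` need not be monotone; the `+ 1` converts level
  -- to grade.
  obtain ⟨c, hc⟩ := exists_grade p ((∑ j ∈ Finset.range N, r (j₀ + j)) + 1)
  have h1 := hc c le_rfl
  refine ⟨c, ?_⟩
  have hxc := hx c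
  generalize (p.1 c : LeanBox n) = a at h1 hxc
  rcases a with _ | ⟨s, k⟩
  · simp [LeanBox.grade] at h1
  simp only [LeanBox.grade, Nat.add_le_add_iff_right] at h1
  have hlev : ∀ j, ∃ l, j < N → Refines (cube s k) (cube (r (j₀ + j)) l) := by
    intro j
    by_cases hj : j < N
    · obtain ⟨l, hl⟩ := exists_refines_level ((Finset.single_le_sum
        (f := fun j => r (j₀ + j)) (fun _ _ => Nat.zero_le _) (Finset.mem_range.2 hj)).trans h1) k
      exact ⟨l, fun _ => hl⟩
    · exact ⟨0, fun h => (hj h).elim⟩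
  choose l hl using hlev
  -- Milestones carry their stage, so they remain distinct even when `r` repeats a level.
  have hinj : Function.Injective fun j => (j₀ + j, l j) := fun i j hij => by
    have := congrArg Prod.fst hij
    simpa using this
  have hsub : ((Finset.range N).map ⟨_, hinj⟩ : Set (ℕ × (Fin n → ℤ))) ⊆
      milestones f r (cube s k) := by
    intro q hq
    obtain ⟨j, hj, rfl⟩ := Finset.mem_map.1 (Finset.mem_coe.1 hq)
    have hj' := hl j (Finset.mem_range.1 hj)
    refine ⟨hj', h _ _ ⟨x, toSet_mono hj' hxc, hj₀.trans ?_⟩⟩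
    exact Nat.cast_le.2 (Nat.le_add_right j₀ j)
  have h2 := Set.ncard_le_ncard hsub (finite_milestones f hr _)
  rwa [Set.ncard_coe_finset, Finset.card_map, Finset.card_range] at h2

end Milestones

end NaturalTopology

/-! ### Assembling the refinement morphism -/

open NaturalTopology in
theorem exists_boxMap_of_bishopContinuous {n m : ℕ} [NeZero n] [NeZero m]
    {f : EuclideanSpace ℝ (Fin n) → EuclideanSpace ℝ (Fin m)} (hf : BishopContinuous f) :
    ∃ g : LeanBox n → LeanBox m, (∀ a b, LeanBox.Refines a b → LeanBox.Refines (g a) (g b)) ∧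
      (∀ a, ∀ x ∈ a.toSet, f x ∈ (g a).toSet) ∧
      ∀ p : (leanPre n).Point, (leanPre m).IsPoint fun k => g (p.1 k) := by
  choose r hr h using fun j => hf.exists_level j (ε := stageBound n j)
    (by unfold stageBound; positivity)
  refine ⟨boxMap f r, fun a b => boxMap_refines f hr, fun a x => map_mem_boxMap f hr, fun p => ?_⟩
  refine LeanBox.isPoint_of_grade_unbounded _
    (fun i j hij => boxMap_refines f hr (point_refines p hij)) fun N => ?_
  obtain ⟨j, hj⟩ := exists_le_ncard_milestones f hr h p N
  exact ⟨j, hj.trans (ncard_milestones_le_grade f _)⟩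

theorem mainTheorem5 (n m : ℕ) [NeZero n] [NeZero m]
    (f : EuclideanSpace ℝ (Fin n) → EuclideanSpace ℝ (Fin m))
    (hf : NaturalTopology.BishopContinuous f) :
    ∃ g : NaturalTopology.RefinementMorphism
        (NaturalTopology.leanSpraid n).toNaturalSpace (NaturalTopology.leanSpraid m).toNaturalSpace,
      ∀ p : (NaturalTopology.leanSpraid n).Point,
        NaturalTopology.value (g.map p) = f (NaturalTopology.value p) := by
  open NaturalTopology in
  obtain ⟨g, hmono, hmem, hpt⟩ := exists_boxMap_of_bishopContinuous hf
  have hval : ∀ p : (leanSpraid n).Point,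
      value (⟨fun k => g (p.1 k), hpt p⟩ : (leanSpraid m).Point) = f (value p) := fun p =>
    -- Both sides lie in all boxes of the image point, which have only one common element.
    eq_of_touch _ _ ((value_eq_iff _ _).1 rfl) _ _ (value_mem _)
      fun j => hmem _ _ (value_mem p j)
  refine ⟨⟨g, hpt, fun p q hpq => ?_, hmono⟩, hval⟩
  by_contra hne
  refine (value_eq_iff _ _).1 ?_ hpq
  rw [hval, hval, (value_eq_iff p q).2 hne]
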